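/- For $x\in\{0,1\}^N$ write $|x|=x_1+\dots+x_N$, and let $\{0,1\}^N_{\le n}=\{x\in\{0,1\}^N : |x|\le n\}$. For $X\subseteq\{0,1\}^N$, a function $f\colon X\to\{0,1\}$ and $\epsilon>0$, let the $\epsilon$-approximate degree $\deg_\epsilon(f)$ be the least total degree of a real polynomial $p$ in $N$ variables with $|f(x)-p(x)|\le\epsilon$ for all $x\in X$. A $k$-DNF formula in $x_1,\dots,x_N$ is a disjunction of zero or more terms, each a conjunction of at most $k$ literals from among $x_1,\overline{x_1},\dots,x_N,\overline{x_N}$; a $k$-CNF formula is a conjunction of zero or more clauses, each a disjunction of at most $k$ such literals. (An empty disjunction is $0$ and an empty conjunction is $1$; we also put $0^0=1$.) **Theorem.** (1) There is an absolute constant $c>1$ such that for all integers $N,n,k\ge0$, every real $0<\epsilon\le 1/2$, and every function $f\colon\{0,1\}^N_{\le n}\to\{0,1\}$ that is representable on its domain by a $k$-DNF or a $k$-CNF formula, $$\deg_\epsilon(f)\le c\,(\sqrt2)^k\,n^{\frac{k}{k+1}}\left(\log_2\frac1\epsilon\right)^{\frac1{k+1}}.$$ (2) In particular, for every fixed integer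 $k\ge0$ there is a constant $C>0$ such that for all integers $N,n\ge0$ and every $f\colon\{0,1\}^N_{\le n}\to\{0,1\}$ that is representable on its domain by a $k$-DNF or a $k$-CNF formula, $$\deg_{1/3}(f)\le C\,n^{\frac{k}{k+1}}.$$ -/

import Mathlib

/-- The value of a bit, as a real number. -/
def bitVal (b : Bool) : ℝ := if b then 1 else 0

/-- The Hamming weight `|x| = x₁ + ⋯ + x_N` of a string. -/
def hammingWeight {N : ℕ} (x : Fin N → Bool) : ℕ :=
  (Finset.univ.filter fun i => x i = true).card

/-- The set of strings in `{0,1}^N` of Hamming weight at most `n`. -/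
def cubeLE (N n : ℕ) : Set (Fin N → Bool) := {x | hammingWeight x ≤ n}

/-- The real polynomial `p` satisfies `|f x - p x| ≤ ε` at every point of the domain `X` of `f`. -/
def Approximates {N : ℕ} {X : Set (Fin N → Bool)} (p : MvPolynomial (Fin N) ℝ)
    (f : X → Bool) (ε : ℝ) : Prop :=
  ∀ x : X, |bitVal (f x) - MvPolynomial.eval (fun i => bitVal (x.1 i)) p| ≤ ε

/-- The `ε`-approximate degree of `f`: the least total degree of a real polynomial that approximates
`f` pointwise within `ε` on its domain. For `0 ≤ ε` this minimum is attained, see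
`exists_approximates_totalDegree_eq`. -/
noncomputable def approxDegree {N : ℕ} {X : Set (Fin N → Bool)} (ε : ℝ) (f : X → Bool) : ℕ :=
  sInf {d | ∃ p : MvPolynomial (Fin N) ℝ, p.totalDegree = d ∧ Approximates p f ε}

/-- Literals in the variables `x₁, …, x_N`: `(i, true)` is `xᵢ` and `(i, false)` is its negation. -/
abbrev Lit (N : ℕ) := Fin N × Bool

/-- The literal `l` is true on the input `x`. -/
def Lit.Holds {N : ℕ} (l : Lit N) (x : Fin N → Bool) : Prop := x l.1 = l.2

/-- `f` is represented on its domain by a `k`-DNF formula: a disjunction of zero or more terms, each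
of them a conjunction of at most `k` literals (the empty disjunction is false and the empty
conjunction is true). -/
def IsKDNF {N : ℕ} {X : Set (Fin N → Bool)} (k : ℕ) (f : X → Bool) : Prop :=
  ∃ F : Finset (Finset (Lit N)), (∀ t ∈ F, t.card ≤ k) ∧
    ∀ x : X, f x = true ↔ ∃ t ∈ F, ∀ l ∈ t, l.Holds x.1

/-- `f` is represented on its domain by a `k`-CNF formula: a conjunction of zero or more clauses,
each of them a disjunction of at most `k` literals. -/
def IsKCNF {N : ℕ} {X : Set (Fin N → Bool)} (k : ℕ) (f : X → Bool) : Prop :=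
  ∃ F : Finset (Finset (Lit N)), (∀ t ∈ F, t.card ≤ k) ∧
    ∀ x : X, f x = true ↔ ∀ t ∈ F, ∃ l ∈ t, l.Holds x.1

/-- Every Boolean function is represented exactly by some polynomial, so the minimum in the
definition of the approximate degree is over a nonempty set. -/
theorem exists_approximates {N : ℕ} {X : Set (Fin N → Bool)} (f : X → Bool) {ε : ℝ} (hε : 0 ≤ ε) :
    ∃ p : MvPolynomial (Fin N) ℝ, Approximates p f ε := by
  classical
  refine ⟨∑ a : Fin N → Bool, MvPolynomial.C (if h : a ∈ X then bitVal (f ⟨a, h⟩) else 0) *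
    ∏ i, (if a i then MvPolynomial.X i else 1 - MvPolynomial.X i), fun x => ?_⟩
  have key : ∀ a : Fin N → Bool, a ≠ x.1 →
      ∏ i, (MvPolynomial.eval fun i => bitVal (x.1 i))
        (if a i then MvPolynomial.X i else 1 - MvPolynomial.X i) = 0 := by
    intro a ha
    obtain ⟨i, hi⟩ := Function.ne_iff.mp ha
    refine Finset.prod_eq_zero (Finset.mem_univ i) ?_
    cases h1 : a i <;> cases h2 : x.1 i <;> simp_all [bitVal]
  have key2 : ∏ i, (MvPolynomial.eval fun i => bitVal (x.1 i))
        (if x.1 i then MvPolynomial.X i else 1 - MvPolynomial.X i) = 1 := by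
    refine Finset.prod_eq_one fun i _ => ?_
    cases h2 : x.1 i <;> simp [bitVal, h2]
  rw [map_sum, Finset.sum_eq_single x.1]
  · rw [map_mul, map_prod, key2]
    simpa using hε
  · intro a _ ha
    rw [map_mul, map_prod, key a ha, mul_zero]
  · simp

/-- The minimum in the definition of the approximate degree is attained. -/
theorem exists_approximates_totalDegree_eq {N : ℕ} {X : Set (Fin N → Bool)} (f : X → Bool) {ε : ℝ}
    (hε : 0 ≤ ε) :
    ∃ p : MvPolynomial (Fin N) ℝ, p.totalDegree = approxDegree ε f ∧ Approximates p f ε := by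
  obtain ⟨p, hp⟩ := exists_approximates f hε
  exact Nat.sInf_mem
    (s := {d | ∃ p : MvPolynomial (Fin N) ℝ, p.totalDegree = d ∧ Approximates p f ε})
    ⟨_, p, rfl, hp⟩

/-- The sum of the absolute values of the coefficients of a real polynomial. -/
noncomputable def coeffNorm (p : Polynomial ℝ) : ℝ := p.sum fun _ a => |a|

section CoeffNorm
open Polynomial

theorem coeffNorm_eq_sum_range {p : ℝ[X]} {n : ℕ} (h : p.natDegree < n) :
    coeffNorm p = ∑ i ∈ Finset.range n, |p.coeff i| :=
  Polynomial.sum_over_range' p (fun _ => abs_zero) n h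

theorem coeffNorm_nonneg (p : ℝ[X]) : 0 ≤ coeffNorm p :=
  Finset.sum_nonneg fun _ _ => abs_nonneg _

theorem coeffNorm_add_le (p q : ℝ[X]) : coeffNorm (p + q) ≤ coeffNorm p + coeffNorm q := by
  set n := max p.natDegree q.natDegree + 1
  have hp : p.natDegree < n := by omega
  have hq : q.natDegree < n := by omega
  have hpq : (p + q).natDegree < n := by
    have := natDegree_add_le p q
    omega
  rw [coeffNorm_eq_sum_range hp, coeffNorm_eq_sum_range hq, coeffNorm_eq_sum_range hpq,
    ← Finset.sum_add_distrib]
  exact Finset.sum_le_sum fun i _ => by rw [coeff_add]; exact abs_add_le _ _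

theorem coeffNorm_zero : coeffNorm 0 = 0 := by simp [coeffNorm]

theorem coeffNorm_sum_le {ι : Type*} (s : Finset ι) (p : ι → ℝ[X]) :
    coeffNorm (∑ i ∈ s, p i) ≤ ∑ i ∈ s, coeffNorm (p i) :=
  Finset.le_sum_of_subadditive coeffNorm coeffNorm_zero.le coeffNorm_add_le s p

theorem coeffNorm_C_mul (a : ℝ) (p : ℝ[X]) : coeffNorm (C a * p) = |a| * coeffNorm p := by
  have h : (C a * p).natDegree < p.natDegree + 1 :=
    Nat.lt_succ_of_le (natDegree_C_mul_le a p)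
  rw [coeffNorm_eq_sum_range h, coeffNorm_eq_sum_range (Nat.lt_succ_self p.natDegree),
    Finset.mul_sum]
  exact Finset.sum_congr rfl fun i _ => by rw [coeff_C_mul, abs_mul]

theorem coeffNorm_X_pow_mul (n : ℕ) (p : ℝ[X]) : coeffNorm (X ^ n * p) = coeffNorm p := by
  have h : (X ^ n * p).natDegree < n + (p.natDegree + 1) := by
    have := natDegree_mul_le (p := X ^ n) (q := p)
    have := natDegree_X_pow_le (R := ℝ) n
    omega
  rw [coeffNorm_eq_sum_range h, coeffNorm_eq_sum_range (Nat.lt_succ_self p.natDegree),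
    Finset.sum_range_add, Finset.sum_eq_zero, zero_add]
  · exact Finset.sum_congr rfl fun i _ => by rw [add_comm n i, coeff_X_pow_mul]
  · intro i hi
    rw [coeff_X_pow_mul', if_neg (by simpa using hi), abs_zero]

theorem coeffNorm_one : coeffNorm 1 = 1 := by
  rw [coeffNorm_eq_sum_range (n := 1) (by simp)]
  simp

theorem coeffNorm_mul_le (p q : ℝ[X]) : coeffNorm (p * q) ≤ coeffNorm p * coeffNorm q := by
  conv_lhs => rw [p.as_sum_range_C_mul_X_pow, Finset.sum_mul]
  refine (coeffNorm_sum_le _ _).trans_eq ?_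
  rw [coeffNorm_eq_sum_range (Nat.lt_succ_self p.natDegree), Finset.sum_mul]
  exact Finset.sum_congr rfl fun i _ => by rw [mul_assoc, coeffNorm_C_mul, coeffNorm_X_pow_mul]

theorem coeffNorm_pow_le (p : ℝ[X]) (n : ℕ) : coeffNorm (p ^ n) ≤ coeffNorm p ^ n := by
  induction n with
  | zero => simp [coeffNorm_one]
  | succ n ih =>
    rw [pow_succ, pow_succ]
    exact (coeffNorm_mul_le _ _).trans (mul_le_mul_of_nonneg_right ih (coeffNorm_nonneg p))

theorem coeffNorm_prod_le {ι : Type*} (s : Finset ι) (p : ι → ℝ[X]) :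
    coeffNorm (∏ i ∈ s, p i) ≤ ∏ i ∈ s, coeffNorm (p i) := by
  classical
  induction s using Finset.induction_on with
  | empty => simp [coeffNorm_one]
  | insert a s ha ih =>
    rw [Finset.prod_insert ha, Finset.prod_insert ha]
    exact (coeffNorm_mul_le _ _).trans (mul_le_mul_of_nonneg_left ih (coeffNorm_nonneg _))

theorem coeffNorm_C (a : ℝ) : coeffNorm (C a) = |a| := by
  rw [← mul_one (C a), coeffNorm_C_mul, coeffNorm_one, mul_one]

theorem coeffNorm_X_pow (n : ℕ) : coeffNorm (X ^ n) = 1 := by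
  rw [← mul_one (X ^ n), coeffNorm_X_pow_mul, coeffNorm_one]

theorem coeffNorm_expand_le (a : ℕ) (p : ℝ[X]) : coeffNorm (expand ℝ a p) ≤ coeffNorm p := by
  conv_lhs => rw [p.as_sum_range_C_mul_X_pow, map_sum]
  refine (coeffNorm_sum_le _ _).trans_eq ?_
  rw [coeffNorm_eq_sum_range (Nat.lt_succ_self p.natDegree)]
  refine Finset.sum_congr rfl fun i _ => ?_
  rw [map_mul, expand_C, map_pow, expand_X, ← pow_mul, coeffNorm_C_mul, coeffNorm_X_pow, mul_one]

theorem coeffNorm_T_comp_le {y : ℝ[X]} (hy : coeffNorm y ≤ 3) (n : ℕ) :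
    coeffNorm ((Chebyshev.T ℝ n).comp y) ≤ 7 ^ n := by
  induction n using Nat.twoStepInduction with
  | zero => simp [coeffNorm_one]
  | one => simpa using hy.trans (by norm_num)
  | more n h0 h1 =>
    have e : (Chebyshev.T ℝ ((n + 2 : ℕ) : ℤ)).comp y =
        C 2 * (y * (Chebyshev.T ℝ ((n + 1 : ℕ) : ℤ)).comp y) +
          C (-1) * (Chebyshev.T ℝ (n : ℤ)).comp y := by
      push_cast
      rw [Chebyshev.T_add_two]
      have h2 : (C (2 : ℝ) : ℝ[X]) = 2 := map_ofNat C 2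
      simp [mul_assoc, h2]
      ring
    rw [e]
    refine (coeffNorm_add_le _ _).trans ?_
    rw [coeffNorm_C_mul, coeffNorm_C_mul]
    have h2 := (coeffNorm_mul_le y ((Chebyshev.T ℝ ((n + 1 : ℕ) : ℤ)).comp y)).trans
      (mul_le_mul hy h1 (coeffNorm_nonneg _) (by norm_num))
    norm_num [pow_succ] at *
    nlinarith [pow_pos (show (0 : ℝ) < 7 by norm_num) n]

theorem natDegree_T_comp_le {y : ℝ[X]} (hy : y.natDegree ≤ 1) (n : ℕ) :
    ((Chebyshev.T ℝ n).comp y).natDegree ≤ n := by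
  refine natDegree_comp_le.trans ?_
  rw [Chebyshev.natDegree_T]
  simpa using Nat.mul_le_mul_left n hy

theorem one_add_sq_mul_le_eval_T {μ : ℝ} (hμ : 0 ≤ μ) (n : ℕ) :
    1 + n ^ 2 * μ ≤ (Chebyshev.T ℝ n).eval (1 + μ) := by
  suffices h : 1 + n ^ 2 * μ ≤ (Chebyshev.T ℝ n).eval (1 + μ) ∧
      (2 * n + 1) * μ ≤ (Chebyshev.T ℝ (n + 1 : ℕ)).eval (1 + μ) - (Chebyshev.T ℝ n).eval (1 + μ)
    from h.1
  induction n with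
  | zero => simp
  | succ n ih =>
    obtain ⟨h1, h2⟩ := ih
    have e : (Chebyshev.T ℝ ((n + 1 + 1 : ℕ) : ℤ)).eval (1 + μ) =
        2 * (1 + μ) * (Chebyshev.T ℝ ((n + 1 : ℕ) : ℤ)).eval (1 + μ) -
          (Chebyshev.T ℝ (n : ℤ)).eval (1 + μ) := by
      have := Chebyshev.T_add_two ℝ (n : ℤ)
      push_cast
      rw [add_assoc, one_add_one_eq_two, this]
      simp
    have h3 := Chebyshev.one_le_eval_T_real ((n + 1 : ℕ) : ℤ) (show 1 ≤ 1 + μ by linarith)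
    refine ⟨?_, ?_⟩
    · push_cast at *
      nlinarith
    · rw [e]
      push_cast at *
      nlinarith [mul_le_mul_of_nonneg_left h3 hμ]

/-- A bounded polynomial that is `1` at `1` and vanishes at the prescribed point `1 - v`. -/
theorem exists_chebyshev_root {v : ℝ} (hv : 0 < v) {e : ℕ} (he : 1 ≤ (e : ℝ) ^ 2 * v) :
    ∃ Q : ℝ[X], Q.natDegree ≤ e ∧ coeffNorm Q ≤ 7 ^ e ∧ Q.eval 1 = 1 ∧ Q.eval (1 - v) = 0 ∧
      ∀ w, 0 ≤ w → w ≤ 1 → |Q.eval w| ≤ 1 := by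
  have he0 : (0 : ℝ) < e := by
    rcases Nat.eq_zero_or_pos e with h | h
    · subst h; norm_num at he
    · exact_mod_cast h
  set θ := Real.pi / (2 * e) with hθ
  set β := (1 - Real.cos θ) / v with hβ
  have hβ0 : 0 ≤ β := div_nonneg (by linarith [Real.cos_le_one θ]) hv.le
  have hβ2 : β ≤ 2 := by
    rw [hβ, div_le_iff₀ hv]
    have h1 := Real.one_sub_sq_div_two_le_cos (x := θ)
    have h2 : θ ^ 2 * (e : ℝ) ^ 2 = Real.pi ^ 2 / 4 := by
      rw [hθ]; field_simp; norm_num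
    have h3 : Real.pi ^ 2 ≤ 16 := by nlinarith [Real.pi_le_four, Real.pi_pos]
    have h4 : θ ^ 2 ≤ 4 * v := by
      have h5 : θ ^ 2 * 1 ≤ θ ^ 2 * ((e : ℝ) ^ 2 * v) :=
        mul_le_mul_of_nonneg_left he (sq_nonneg _)
      nlinarith
    linarith
  have heval : ∀ w, (C (1 - β) + C β * X : ℝ[X]).eval w = 1 - β * (1 - w) := by
    intro w
    simp
    ring
  have hnorm : coeffNorm (C (1 - β) + C β * X : ℝ[X]) ≤ 3 := by
    refine (coeffNorm_add_le _ _).trans ?_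
    have hX : coeffNorm (X : ℝ[X]) = 1 := by simpa using coeffNorm_X_pow 1
    rw [coeffNorm_C, coeffNorm_C_mul, hX, abs_of_nonneg hβ0]
    have : |1 - β| ≤ 1 := abs_le.mpr ⟨by linarith, by linarith⟩
    linarith
  refine ⟨(Chebyshev.T ℝ e).comp (C (1 - β) + C β * X), natDegree_T_comp_le ?_ e,
    coeffNorm_T_comp_le hnorm e, ?_, ?_, fun w h0 h1 => ?_⟩
  · compute_degree
  · rw [eval_comp, heval]
    simp
  · rw [eval_comp, heval, show 1 - β * (1 - (1 - v)) = Real.cos θ by rw [hβ]; field_simp; ring,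
      Chebyshev.T_real_cos, hθ]
    rw [show (((e : ℕ) : ℤ) : ℝ) * (Real.pi / (2 * e)) = Real.pi / 2 by push_cast; field_simp,
      Real.cos_pi_div_two]
  · rw [eval_comp, heval]
    exact Chebyshev.abs_eval_T_real_le_one _ (abs_le.mpr ⟨by nlinarith, by nlinarith⟩)

/-- A polynomial that is `1` at `1` and at most `1 / 2` in absolute value on `[0, 1 - v]`. -/
theorem exists_chebyshev_half {v : ℝ} (hv : 0 < v) (hv1 : v ≤ 1) {e : ℕ}
    (he : 1 ≤ (e : ℝ) ^ 2 * v) :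
    ∃ Q : ℝ[X], Q.natDegree ≤ e ∧ coeffNorm Q ≤ 7 ^ e ∧ Q.eval 1 = 1 ∧
      ∀ w, 0 ≤ w → w ≤ 1 - v → |Q.eval w| ≤ 1 / 2 := by
  set t := (Chebyshev.T ℝ e).eval (1 + v) with ht
  have ht2 : 2 ≤ t := by linarith [one_add_sq_mul_le_eval_T hv.le e]
  have heval : ∀ w, (C v + X : ℝ[X]).eval w = v + w := by
    intro w
    simp
  have hnorm : coeffNorm (C v + X : ℝ[X]) ≤ 3 := by
    refine (coeffNorm_add_le _ _).trans ?_
    have hX : coeffNorm (X : ℝ[X]) = 1 := by simpa using coeffNorm_X_pow 1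
    rw [coeffNorm_C, hX, abs_of_pos hv]
    linarith
  have ht1 : |t⁻¹| ≤ 1 / 2 := by
    rw [abs_of_pos (by positivity), one_div]
    exact inv_anti₀ (by norm_num) ht2
  refine ⟨C t⁻¹ * (Chebyshev.T ℝ e).comp (C v + X), (natDegree_C_mul_le _ _).trans
    (natDegree_T_comp_le (by compute_degree) e), ?_, ?_, fun w h0 h1 => ?_⟩
  · rw [coeffNorm_C_mul]
    have := coeffNorm_T_comp_le hnorm e
    nlinarith [coeffNorm_nonneg ((Chebyshev.T ℝ e).comp (C v + X))]
  · rw [eval_mul, eval_C, eval_comp, heval, add_comm v 1, ← ht]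
    exact inv_mul_cancel₀ (by positivity)
  · rw [eval_mul, eval_C, eval_comp, heval, abs_mul]
    have := Chebyshev.abs_eval_T_real_le_one (e : ℤ) (x := v + w)
      (abs_le.mpr ⟨by linarith, by linarith⟩)
    nlinarith [abs_nonneg (t⁻¹), abs_nonneg ((Chebyshev.T ℝ e).eval (v + w))]

end CoeffNorm

section UnivariateOr
open Polynomial

theorem exists_polynomial_vanishing_and_small {v : ℕ → ℝ} {e : ℕ → ℕ} {l : ℕ} (hl : 1 ≤ l)
    (hv : ∀ i, 1 ≤ i → i ≤ l → 0 < v i) (hv1 : v l ≤ 1)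
    (he : ∀ i, 1 ≤ i → i ≤ l → 1 ≤ (e i : ℝ) ^ 2 * v i) :
    ∃ Q : ℝ[X], Q.natDegree ≤ ∑ i ∈ Finset.Ico 1 l, e i + l * e l ∧
      coeffNorm Q ≤ 7 ^ (∑ i ∈ Finset.Ico 1 l, e i + l * e l) ∧ Q.eval 1 = 1 ∧
      (∀ i, 1 ≤ i → i < l → Q.eval (1 - v i) = 0) ∧
      ∀ w, 0 ≤ w → w ≤ 1 - v l → |Q.eval w| ≤ (1 / 2) ^ l := by
  have h : ∀ i, ∃ Q : ℝ[X], 1 ≤ i ∧ i ≤ l → Q.natDegree ≤ e i ∧ coeffNorm Q ≤ 7 ^ e i ∧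
      Q.eval 1 = 1 ∧ Q.eval (1 - v i) = 0 ∧ ∀ w, 0 ≤ w → w ≤ 1 → |Q.eval w| ≤ 1 := by
    intro i
    by_cases hi : 1 ≤ i ∧ i ≤ l
    · obtain ⟨Q, hQ⟩ := exists_chebyshev_root (hv i hi.1 hi.2) (he i hi.1 hi.2)
      exact ⟨Q, fun _ => hQ⟩
    · exact ⟨0, fun h => absurd h hi⟩
  choose A hA using h
  obtain ⟨B, hB1, hB2, hB3, hB4⟩ := exists_chebyshev_half (hv l hl le_rfl) hv1 (he l hl le_rfl)
  have hA' : ∀ i ∈ Finset.Ico 1 l, 1 ≤ i ∧ i ≤ l := fun i hi =>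
    ⟨(Finset.mem_Ico.mp hi).1, (Finset.mem_Ico.mp hi).2.le⟩
  refine ⟨(∏ i ∈ Finset.Ico 1 l, A i) * B ^ l, ?_, ?_, ?_, ?_, ?_⟩
  · refine natDegree_mul_le.trans (add_le_add ?_ ?_)
    · exact (natDegree_prod_le _ _).trans (Finset.sum_le_sum fun i hi => (hA i (hA' i hi)).1)
    · exact natDegree_pow_le.trans (Nat.mul_le_mul_left l hB1)
  · rw [pow_add, mul_comm l, pow_mul, ← Finset.prod_pow_eq_pow_sum]
    refine (coeffNorm_mul_le _ _).trans (mul_le_mul ?_ ?_ (coeffNorm_nonneg _) (by positivity))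
    · exact (coeffNorm_prod_le _ _).trans (Finset.prod_le_prod (fun _ _ => coeffNorm_nonneg _)
        fun i hi => (hA i (hA' i hi)).2.1)
    · exact (coeffNorm_pow_le _ _).trans (pow_le_pow_left₀ (coeffNorm_nonneg _) hB2 l)
  · rw [eval_mul, eval_pow, hB3, eval_prod, Finset.prod_eq_one, one_pow, one_mul]
    exact fun i hi => (hA i (hA' i hi)).2.2.1
  · intro i h1 h2
    rw [eval_mul, eval_prod, Finset.prod_eq_zero (Finset.mem_Ico.mpr ⟨h1, h2⟩)
      (hA i ⟨h1, h2.le⟩).2.2.2.1, zero_mul]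
  · intro w h0 h1
    rw [eval_mul, eval_pow, eval_prod, abs_mul, abs_pow, Finset.abs_prod,
      ← one_mul ((1 / 2 : ℝ) ^ l)]
    have hw1 : w ≤ 1 := by linarith [hv l hl le_rfl]
    refine mul_le_mul ?_ (pow_le_pow_left₀ (abs_nonneg _) (hB4 w h0 h1) l) (by positivity)
      zero_le_one
    exact Finset.prod_le_one (fun _ _ => abs_nonneg _)
      fun i hi => (hA i (hA' i hi)).2.2.2.2 w h0 hw1

theorem sum_inv_sqrt_le (l : ℕ) : ∑ i ∈ Finset.range l, 1 / √((i : ℝ) + 1) ≤ 2 * √(l : ℝ) := by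
  induction l with
  | zero => simp
  | succ l ih =>
    rw [Finset.sum_range_succ]
    push_cast
    have h1 : 0 < √((l : ℝ) + 1) := Real.sqrt_pos.mpr (by positivity)
    have h2 := Real.sq_sqrt (show (0 : ℝ) ≤ l + 1 by positivity)
    have h3 := Real.sq_sqrt (show (0 : ℝ) ≤ l by positivity)
    have h4 : 1 / √((l : ℝ) + 1) ≤ 2 * √((l : ℝ) + 1) - 2 * √(l : ℝ) := by
      rw [div_le_iff₀ h1]
      nlinarith [sq_nonneg (√((l : ℝ) + 1) - √(l : ℝ))]
    linarith

theorem one_sub_pow_le {s : ℝ} (h0 : 0 ≤ s) (h1 : s ≤ 1) {a : ℕ} (ha : a * s ≤ 1) :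
    (1 - s) ^ a ≤ 1 - a * s / 2 := by
  have hb : 1 + a * s ≤ (1 + s) ^ a := one_add_mul_le_pow (by linarith) a
  have hm : (1 - s) ^ a * (1 + s) ^ a ≤ 1 := by
    rw [← mul_pow]
    exact pow_le_one₀ (by nlinarith) (by nlinarith)
  have hp : 0 ≤ (1 - s) ^ a := pow_nonneg (by linarith) a
  have has : 0 ≤ a * s := by positivity
  have h2 : (1 - s) ^ a * (1 + a * s) ≤ 1 := (mul_le_mul_of_nonneg_left hb hp).trans hm
  nlinarith

theorem sum_ceil_sqrt_le {x : ℝ} {l : ℕ} (hl : 1 ≤ l) (hx : l ≤ x) :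
    ((∑ i ∈ Finset.Ico 1 l, ⌈√(x / i)⌉₊ + l * ⌈√(x / l)⌉₊ : ℕ) : ℝ) ≤ 6 * √(x * l) := by
  have hl0 : (0 : ℝ) < l := by exact_mod_cast hl
  have hx0 : 0 < x := hl0.trans_le hx
  have hc : ∀ i : ℕ, 1 ≤ i → i ≤ l → (⌈√(x / i)⌉₊ : ℝ) ≤ 2 * √x * (1 / √(i : ℝ)) := by
    intro i h1 h2
    have hi0 : (0 : ℝ) < i := by exact_mod_cast h1
    have hi : (i : ℝ) ≤ l := by exact_mod_cast h2
    have h3 : 1 ≤ √(x / i) := Real.one_le_sqrt.mpr ((one_le_div hi0).mpr (hi.trans hx))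
    have h4 := Nat.ceil_lt_add_one (Real.sqrt_nonneg (x / i))
    have h5 : √(x / i) = √x * (1 / √(i : ℝ)) := by rw [Real.sqrt_div hx0.le]; ring
    rw [mul_assoc, ← h5]
    linarith
  have hsum : (∑ i ∈ Finset.Ico 1 l, (⌈√(x / i)⌉₊ : ℝ)) ≤ 2 * √x * (2 * √(l : ℝ)) := by
    calc _ ≤ ∑ i ∈ Finset.Ico 1 l, 2 * √x * (1 / √(i : ℝ)) := Finset.sum_le_sum fun i hi =>
          hc i (Finset.mem_Ico.mp hi).1 (Finset.mem_Ico.mp hi).2.le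
      _ = 2 * √x * ∑ i ∈ Finset.range (l - 1), 1 / √((i : ℝ) + 1) := by
          rw [← Finset.mul_sum, Finset.sum_Ico_eq_sum_range]
          simp [add_comm]
      _ ≤ _ := by
          refine mul_le_mul_of_nonneg_left ((sum_inv_sqrt_le _).trans ?_) (by positivity)
          gcongr
          exact Nat.sub_le l 1
  have hlast := mul_le_mul_of_nonneg_left (hc l hl le_rfl) hl0.le
  have hll : (l : ℝ) * (1 / √(l : ℝ)) = √(l : ℝ) := by
    rw [mul_one_div, Real.div_sqrt]
  rw [Real.sqrt_mul hx0.le]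
  push_cast
  have : (l : ℝ) * (2 * √x * (1 / √(l : ℝ))) = 2 * √x * √(l : ℝ) := by
    rw [mul_left_comm, hll]
  linarith

/-- A univariate polynomial of degree at most `d` with controlled coefficients that separates `1`
from the points `1 - j / (2 * n)`, `1 ≤ j ≤ 2 * n`. -/
theorem exists_separating_polynomial {n d : ℕ} {L : ℝ} (hd : 1 ≤ d) (hdn : d ≤ n) (hL : 1 ≤ L)
    (hdL : 432 * (n * L) ≤ (d : ℝ) ^ 2) :
    ∃ q : ℝ[X], q.natDegree ≤ d ∧ coeffNorm q ≤ (2 : ℝ) ^ (2000 * (n * L) / d - L - 1) ∧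
      q.eval 1 = 1 ∧
      ∀ j : ℕ, 1 ≤ j → j ≤ 2 * n → |q.eval (1 - (j : ℝ) / (2 * n))| ≤ (2 : ℝ) ^ (-L - 1) := by
  have hd0 : (0 : ℝ) < d := by exact_mod_cast hd
  have hdn' : (d : ℝ) ≤ n := by exact_mod_cast hdn
  have hn0 : (0 : ℝ) < n := hd0.trans_le hdn'
  set l := ⌈L⌉₊ + 1 with hldef
  have hl1 : 1 ≤ l := by omega
  have hlL : L + 1 ≤ l := by
    rw [hldef]; push_cast; linarith [Nat.le_ceil L]
  have hl3 : (l : ℝ) ≤ 3 * L := by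
    rw [hldef]; push_cast; linarith [Nat.ceil_lt_add_one (show 0 ≤ L by linarith)]
  have hl0 : (0 : ℝ) < l := by linarith
  have hD : 0 < 144 * (n : ℝ) * l := by positivity
  set A := (d : ℝ) ^ 2 / (144 * n * l) with hA
  have hA1 : 1 ≤ A := by
    rw [hA, one_le_div hD]
    nlinarith [mul_le_mul_of_nonneg_left hl3 hn0.le]
  set a := ⌊A⌋₊ with ha
  have haA : (a : ℝ) ≤ A := Nat.floor_le (by linarith)
  have ha1 : 1 ≤ a := Nat.le_floor (by simpa using hA1)
  have ha1' : (1 : ℝ) ≤ a := by exact_mod_cast ha1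
  have ha0 : (0 : ℝ) < a := by linarith
  have haA2 : A ≤ 2 * a := by
    have := Nat.lt_floor_add_one A
    linarith
  have hAl : A * (144 * n * l) = (d : ℝ) ^ 2 := div_mul_cancel₀ _ hD.ne'
  have hal : (a : ℝ) * l ≤ 2 * n := by
    have h1 : (a : ℝ) * l ≤ A * l := mul_le_mul_of_nonneg_right haA hl0.le
    have h2 : A * l * (144 * n) ≤ n * n := by
      calc A * l * (144 * n) = (d : ℝ) ^ 2 := by rw [← hAl]; ring
        _ ≤ n * n := by nlinarith
    nlinarith [mul_pos hn0 hn0]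
  have hln : (l : ℝ) ≤ 2 * n := by nlinarith
  set x := 4 * (n : ℝ) / a with hx
  have hlx : (l : ℝ) ≤ x := by
    rw [hx, le_div_iff₀ ha0]
    nlinarith
  have hx0 : 0 < x := by positivity
  set v : ℕ → ℝ := fun i => 1 - (1 - i / (2 * n)) ^ a with hv
  set e : ℕ → ℕ := fun i => ⌈√(x / i)⌉₊ with he
  have hvi : ∀ i : ℕ, 1 ≤ i → i ≤ l → (i : ℝ) / x ≤ v i := by
    intro i h1 h2
    have h3 : (i : ℝ) ≤ l := by exact_mod_cast h2
    have h4 : (a : ℝ) * (i / (2 * n)) ≤ 1 := by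
      rw [← mul_div_assoc, div_le_one (by positivity)]
      exact (mul_le_mul_of_nonneg_left h3 ha0.le).trans hal
    have h5 : (i : ℝ) / (2 * n) ≤ 1 := by
      rw [div_le_one (by positivity)]
      linarith
    have h6 := one_sub_pow_le (by positivity) h5 h4
    have h7 : (i : ℝ) / x = a * (i / (2 * n)) / 2 := by
      rw [hx]; field_simp; norm_num
    rw [h7]
    simp only [hv]
    linarith
  obtain ⟨Q, hQ1, hQ2, hQ3, hQ4, hQ5⟩ := exists_polynomial_vanishing_and_small (v := v) (e := e) hl1
    (fun i h1 h2 => lt_of_lt_of_le (div_pos (by exact_mod_cast h1) hx0) (hvi i h1 h2))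
    (by
      have : 0 ≤ (1 - (l : ℝ) / (2 * n)) ^ a := by
        refine pow_nonneg (sub_nonneg.mpr ?_) a
        rw [div_le_one (by positivity)]
        exact hln
      simp only [hv]
      linarith)
    (fun i h1 h2 => by
      have hi0 : (0 : ℝ) < i := by exact_mod_cast h1
      have h3 : √(x / i) ≤ e i := Nat.le_ceil _
      have h4 : x / i ≤ (e i : ℝ) ^ 2 := by
        rw [← Real.sq_sqrt (show 0 ≤ x / i by positivity)]
        exact pow_le_pow_left₀ (Real.sqrt_nonneg _) h3 2
      calc (1 : ℝ) = x / i * (i / x) := by field_simp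
        _ ≤ (e i : ℝ) ^ 2 * v i := mul_le_mul h4 (hvi i h1 h2) (by positivity) (by positivity))
  set b := ∑ i ∈ Finset.Ico 1 l, e i + l * e l with hb
  have hb6 : (b : ℝ) ≤ 6 * √(x * l) := sum_ceil_sqrt_le hl1 hlx
  have hb2 : (b : ℝ) ^ 2 * a ≤ 144 * n * l := by
    have h1 : (b : ℝ) ^ 2 ≤ 36 * (x * l) := by
      have h2 := pow_le_pow_left₀ (Nat.cast_nonneg b) hb6 2
      rw [mul_pow, Real.sq_sqrt (by positivity)] at h2
      linarith
    have h3 : x * a = 4 * n := div_mul_cancel₀ _ ha0.ne'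
    calc (b : ℝ) ^ 2 * a ≤ 36 * (x * l) * a := mul_le_mul_of_nonneg_right h1 ha0.le
      _ = 36 * (x * a) * l := by ring
      _ = 144 * n * l := by rw [h3]; ring
  have hba : b * a ≤ d := by
    have h1 : ((b : ℝ) * a) ^ 2 ≤ (d : ℝ) ^ 2 := by
      calc ((b : ℝ) * a) ^ 2 = (b : ℝ) ^ 2 * a * a := by ring
        _ ≤ 144 * n * l * A := mul_le_mul hb2 haA ha0.le hD.le
        _ = (d : ℝ) ^ 2 := by rw [← hAl]; ring
    exact_mod_cast (sq_le_sq₀ (by positivity) hd0.le).mp h1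
  have hbd : (b : ℝ) * d ≤ 204 * (n * l) := by
    have h1 : ((b : ℝ) * d) ^ 2 ≤ (204 * (n * l)) ^ 2 := by
      calc ((b : ℝ) * d) ^ 2 = (b : ℝ) ^ 2 * (A * (144 * n * l)) := by rw [hAl]; ring
        _ ≤ (b : ℝ) ^ 2 * (2 * a * (144 * n * l)) := by gcongr
        _ = (b : ℝ) ^ 2 * a * (288 * (n * l)) := by ring
        _ ≤ 144 * n * l * (288 * (n * l)) := by gcongr
        _ ≤ (204 * (n * l)) ^ 2 := by nlinarith [sq_nonneg ((n : ℝ) * l)]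
    exact (sq_le_sq₀ (by positivity) (by positivity)).mp h1
  refine ⟨expand ℝ a Q, ?_, ?_, ?_, ?_⟩
  · rw [natDegree_expand]
    exact (Nat.mul_le_mul_right a hQ1).trans hba
  · refine (coeffNorm_expand_le a Q).trans (hQ2.trans ?_)
    calc (7 : ℝ) ^ b ≤ ((2 : ℝ) ^ 3) ^ b := pow_le_pow_left₀ (by norm_num) (by norm_num) b
      _ = (2 : ℝ) ^ ((3 * b : ℕ) : ℝ) := by rw [← pow_mul, Real.rpow_natCast]
      _ ≤ _ := by
        refine Real.rpow_le_rpow_of_exponent_le (by norm_num) ?_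
        have h1 : (b : ℝ) ≤ 612 * (n * L) / d := by
          rw [le_div_iff₀ hd0]
          nlinarith [mul_le_mul_of_nonneg_left hl3 hn0.le]
        have h2 : L ≤ n * L / d := by
          rw [le_div_iff₀ hd0]
          nlinarith
        have h3 : 612 * (n * L) / d = 612 * (n * L / d) := mul_div_assoc _ _ _
        have h4 : 2000 * (n * L) / d = 2000 * (n * L / d) := mul_div_assoc _ _ _
        rw [h4]
        push_cast
        linarith
  · rw [expand_eval, one_pow, hQ3]
  · intro j h1 h2
    have hj2 : (j : ℝ) ≤ 2 * n := by exact_mod_cast h2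
    have hjn : (j : ℝ) / (2 * n) ≤ 1 := by
      rw [div_le_one (by positivity)]
      exact hj2
    rw [expand_eval]
    rcases lt_or_ge j l with h | h
    · have := hQ4 j h1 h
      rw [show (1 : ℝ) - v j = (1 - j / (2 * n)) ^ a by simp only [hv]; ring] at this
      rw [this, abs_zero]
      positivity
    · have hlj : (l : ℝ) ≤ j := by exact_mod_cast h
      refine (hQ5 _ (pow_nonneg (by linarith) a) ?_).trans ?_
      · rw [show (1 : ℝ) - v l = (1 - l / (2 * n)) ^ a by simp only [hv]; ring]
        refine pow_le_pow_left₀ (by linarith) ?_ a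
        gcongr
      · rw [one_div, inv_pow, ← Real.rpow_natCast, ← Real.rpow_neg (by norm_num)]
        exact Real.rpow_le_rpow_of_exponent_le (by norm_num) (by linarith)

end UnivariateOr

section ConjunctiveNormalForms
variable {N : ℕ}

/-- The conjunctive normal form with clause set `F` is true on `x`. -/
def CNFHolds (F : Finset (Finset (Lit N))) (x : Fin N → Bool) : Prop :=
  ∀ t ∈ F, ∃ l ∈ t, l.Holds x

open Classical in
/-- The truth value of a conjunctive normal form, as a real number. -/
noncomputable def cnfVal (F : Finset (Finset (Lit N))) (x : Fin N → Bool) : ℝ :=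
  if CNFHolds F x then 1 else 0

/-- The clauses of `F` that contain the literal `xᵢ = aᵢ`, with this literal removed. -/
def residualCNF (F : Finset (Finset (Lit N))) (a : Fin N → Bool) (i : Fin N) :
    Finset (Finset (Lit N)) :=
  (F.filter fun t => (i, a i) ∈ t).image fun t => t.erase (i, a i)

theorem card_le_of_mem_residualCNF {F : Finset (Finset (Lit N))} {k : ℕ}
    (hF : ∀ t ∈ F, t.card ≤ k + 1) {a : Fin N → Bool} {i : Fin N} {t : Finset (Lit N)}
    (ht : t ∈ residualCNF F a i) : t.card ≤ k := by
  obtain ⟨s, hs, rfl⟩ := Finset.mem_image.mp ht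
  obtain ⟨h1, h2⟩ := Finset.mem_filter.mp hs
  rw [Finset.card_erase_of_mem h2]
  have := hF s h1
  omega

theorem CNFHolds.residualCNF {F : Finset (Finset (Lit N))} {a x : Fin N → Bool} {i : Fin N}
    (h : CNFHolds F x) (hi : x i ≠ a i) : CNFHolds (residualCNF F a i) x := by
  intro t ht
  obtain ⟨s, hs, rfl⟩ := Finset.mem_image.mp ht
  obtain ⟨l, hl, hx⟩ := h s (Finset.mem_filter.mp hs).1
  refine ⟨l, Finset.mem_erase.mpr ⟨?_, hl⟩, hx⟩
  rintro rfl
  exact hi hx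

theorem cnfHolds_of_residualCNF {F : Finset (Finset (Lit N))} {a x : Fin N → Bool}
    (ha : CNFHolds F a) (h : ∀ i, x i ≠ a i → CNFHolds (residualCNF F a i) x) :
    CNFHolds F x := by
  intro t ht
  obtain ⟨l, hl, hal⟩ := ha t ht
  by_cases hx : x l.1 = a l.1
  · exact ⟨l, hl, hx.trans hal⟩
  · have hl' : (l.1, a l.1) ∈ t := by
      rw [show a l.1 = l.2 from hal]
      exact hl
    obtain ⟨m, hm, hmx⟩ := h l.1 hx (t.erase (l.1, a l.1))
      (Finset.mem_image.mpr ⟨t, Finset.mem_filter.mpr ⟨ht, hl'⟩, rfl⟩)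
    exact ⟨m, Finset.mem_of_mem_erase hm, hmx⟩

theorem cnfVal_biUnion {ι : Type*} [DecidableEq ι] (s : Finset ι)
    (R : ι → Finset (Finset (Lit N))) (x : Fin N → Bool) :
    cnfVal (s.biUnion R) x = ∏ i ∈ s, cnfVal (R i) x := by
  by_cases h : ∀ i ∈ s, CNFHolds (R i) x
  · have h1 : ∀ i ∈ s, cnfVal (R i) x = 1 := fun i hi => if_pos (h i hi)
    rw [Finset.prod_eq_one h1]
    refine if_pos fun t ht => ?_
    obtain ⟨i, hi, hti⟩ := Finset.mem_biUnion.mp ht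
    exact h i hi t hti
  · push Not at h
    obtain ⟨i, hi, hix⟩ := h
    rw [Finset.prod_eq_zero hi (if_neg hix)]
    exact if_neg fun h => hix fun t ht => h t (Finset.mem_biUnion.mpr ⟨i, hi, ht⟩)

theorem card_ne_le_of_hammingWeight_le {n : ℕ} {x a : Fin N → Bool} (hx : hammingWeight x ≤ n)
    (ha : hammingWeight a ≤ n) : (Finset.univ.filter fun i => x i ≠ a i).card ≤ 2 * n := by
  have h : (Finset.univ.filter fun i => x i ≠ a i) ⊆
      (Finset.univ.filter fun i => x i = true) ∪ Finset.univ.filter fun i => a i = true := by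
    intro i
    cases h1 : x i <;> cases h2 : a i <;> simp [h1, h2]
  have h1 := (Finset.card_le_card h).trans (Finset.card_union_le _ _)
  unfold hammingWeight at hx ha
  omega

open MvPolynomial

/-- A univariate polynomial in a convex combination, with affine weights, of functions whose products
are approximated by polynomials of degree `D` is approximated with only an additive increase of the
degree. -/
theorem exists_approx_eval_convexCombination {ι : Type*} [Fintype ι] {S : Set (Fin N → Bool)}
    {w : ι → MvPolynomial (Fin N) ℝ} (hw : ∀ o, (w o).totalDegree ≤ 1)
    (hw0 : ∀ o, ∀ x ∈ S, 0 ≤ eval (fun i => bitVal (x i)) (w o))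
    (hw1 : ∀ x ∈ S, ∑ o, eval (fun i => bitVal (x i)) (w o) = 1)
    {h : ι → (Fin N → Bool) → ℝ} {D : ℕ} {δ : ℝ}
    (H : ∀ (m : ℕ) (t : Fin m → ι), ∃ p : MvPolynomial (Fin N) ℝ, p.totalDegree ≤ D ∧
      ∀ x ∈ S, |∏ s, h (t s) x - eval (fun i => bitVal (x i)) p| ≤ δ)
    {q : Polynomial ℝ} {d : ℕ} (hq : q.natDegree ≤ d) :
    ∃ p : MvPolynomial (Fin N) ℝ, p.totalDegree ≤ d + D ∧
      ∀ x ∈ S, |q.eval (∑ o, eval (fun i => bitVal (x i)) (w o) * h o x) -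
        eval (fun i => bitVal (x i)) p| ≤ coeffNorm q * δ := by
  choose P hPd hP using H
  refine ⟨∑ m ∈ Finset.range (q.natDegree + 1), C (q.coeff m) *
    ∑ t : Fin m → ι, (∏ s, w (t s)) * P m t, ?_, fun x hx => ?_⟩
  · refine totalDegree_finsetSum_le fun m hm => ?_
    refine (totalDegree_mul _ _).trans ?_
    rw [totalDegree_C, zero_add]
    refine totalDegree_finsetSum_le fun t _ => ?_
    refine (totalDegree_mul _ _).trans (add_le_add ?_ (hPd m t))
    refine (totalDegree_finsetProd _ _).trans ((Finset.sum_le_sum fun s _ => hw (t s)).trans ?_)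
    have := Finset.mem_range.mp hm
    simp
    omega
  · rw [Polynomial.eval_eq_sum_range, map_sum, ← Finset.sum_sub_distrib,
      coeffNorm_eq_sum_range (Nat.lt_succ_self _), Finset.sum_mul]
    refine (Finset.abs_sum_le_sum_abs _ _).trans (Finset.sum_le_sum fun m _ => ?_)
    rw [map_mul, eval_C, ← mul_sub, abs_mul]
    refine mul_le_mul_of_nonneg_left ?_ (abs_nonneg _)
    rw [Fintype.sum_pow, map_sum, ← Finset.sum_sub_distrib]
    calc _ ≤ ∑ t : Fin m → ι, (∏ s, eval (fun i => bitVal (x i)) (w (t s))) * δ := by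
          refine (Finset.abs_sum_le_sum_abs _ _).trans (Finset.sum_le_sum fun t _ => ?_)
          rw [Finset.prod_mul_distrib, map_mul, map_prod, ← mul_sub, abs_mul,
            abs_of_nonneg (Finset.prod_nonneg fun s _ => hw0 (t s) x hx)]
          exact mul_le_mul_of_nonneg_left (hP m t x hx)
            (Finset.prod_nonneg fun s _ => hw0 (t s) x hx)
      _ = δ := by
          have := Fintype.sum_pow (fun o => eval (fun i => bitVal (x i)) (w o)) m
          rw [← Finset.sum_mul, ← this, hw1 x hx, one_pow, one_mul]

/-- The affine polynomial that is `1` where `xᵢ ≠ b` and `0` where `xᵢ = b`. -/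
noncomputable def neIndicator (i : Fin N) (b : Bool) : MvPolynomial (Fin N) ℝ :=
  if b then 1 - X i else X i

theorem totalDegree_neIndicator_le (i : Fin N) (b : Bool) : (neIndicator i b).totalDegree ≤ 1 := by
  cases b
  · simp [neIndicator]
  · simp only [neIndicator, if_true]
    exact (totalDegree_sub _ _).trans (by simp)

theorem eval_neIndicator (i : Fin N) (b : Bool) (x : Fin N → Bool) :
    eval (fun i => bitVal (x i)) (neIndicator i b) = if x i ≠ b then 1 else 0 := by
  cases b <;> cases h : x i <;> simp [neIndicator, bitVal, h]

/-- Reduction of the approximation of a CNF formula to that of CNF formulas of smaller width. -/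
theorem exists_approx_cnfVal_step {n k D d : ℕ} (hn : 1 ≤ n) {δ η : ℝ}
    (H : ∀ G : Finset (Finset (Lit N)), (∀ t ∈ G, t.card ≤ k) →
      ∃ p : MvPolynomial (Fin N) ℝ, p.totalDegree ≤ D ∧
        ∀ x ∈ cubeLE N n, |cnfVal G x - eval (fun i => bitVal (x i)) p| ≤ δ)
    {q : Polynomial ℝ} (hq : q.natDegree ≤ d) (hq1 : q.eval 1 = 1)
    (hη : 0 ≤ η) (hqη : ∀ j : ℕ, 1 ≤ j → j ≤ 2 * n → |q.eval (1 - (j : ℝ) / (2 * n))| ≤ η)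
    {F : Finset (Finset (Lit N))} (hF : ∀ t ∈ F, t.card ≤ k + 1) {a : Fin N → Bool}
    (ha : a ∈ cubeLE N n) (haF : CNFHolds F a) :
    ∃ p : MvPolynomial (Fin N) ℝ, p.totalDegree ≤ d + D ∧
      ∀ x ∈ cubeLE N n, |cnfVal F x - eval (fun i => bitVal (x i)) p| ≤ η + coeffNorm q * δ := by
  classical
  have hn0 : (0 : ℝ) < 2 * n := by
    have : (1 : ℝ) ≤ n := by exact_mod_cast hn
    linarith
  set u : Fin N → MvPolynomial (Fin N) ℝ := fun i => C (1 / (2 * n : ℝ)) * neIndicator i (a i)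
    with hu
  have hudeg : ∀ i, (u i).totalDegree ≤ 1 := fun i => (totalDegree_mul _ _).trans <| by
    rw [totalDegree_C, zero_add]
    exact totalDegree_neIndicator_le i (a i)
  have hueval : ∀ (i : Fin N) (x : Fin N → Bool), eval (fun i => bitVal (x i)) (u i) =
      1 / (2 * n : ℝ) * if x i ≠ a i then 1 else 0 := fun i x => by
    rw [hu, map_mul, eval_C, eval_neIndicator]
  have husum : ∀ x ∈ cubeLE N n, ∑ i, eval (fun i => bitVal (x i)) (u i) ≤ 1 := by
    intro x hx
    have h1 : ((Finset.univ.filter fun i => x i ≠ a i).card : ℝ) ≤ 2 * n := by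
      exact_mod_cast card_ne_le_of_hammingWeight_le hx ha
    simp_rw [hueval]
    rw [← Finset.mul_sum, Finset.sum_boole, one_div, inv_mul_le_iff₀ hn0]
    linarith
  set w : Option (Fin N) → MvPolynomial (Fin N) ℝ := fun o => o.elim (1 - ∑ i, u i) u with hw
  set R : Option (Fin N) → Finset (Finset (Lit N)) := fun o => o.elim ∅ (residualCNF F a) with hR
  have hRk : ∀ o, ∀ t ∈ R o, t.card ≤ k := by
    rintro (_ | i) t ht
    · simp [hR] at ht
    · exact card_le_of_mem_residualCNF hF ht
  obtain ⟨p, hpd, hp⟩ := exists_approx_eval_convexCombination (S := cubeLE N n) (w := w)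
    (h := fun o => cnfVal (R o)) (D := D) (δ := δ) (q := q) (d := d)
    (by
      rintro (_ | i)
      · refine (totalDegree_sub _ _).trans (max_le (by simp) ?_)
        exact totalDegree_finsetSum_le fun i _ => hudeg i
      · exact hudeg i)
    (by
      rintro (_ | i) x hx
      · simp only [hw, Option.elim, map_sub, map_one, map_sum]
        linarith [husum x hx]
      · simp only [hw, Option.elim, hueval]
        split_ifs <;> positivity)
    (by
      intro x hx
      simp [hw, Fintype.sum_option])
    (by
      intro m t
      obtain ⟨p, hpd, hp⟩ := H (Finset.univ.biUnion fun s => R (t s)) (by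
        intro c hc
        obtain ⟨s, _, hs⟩ := Finset.mem_biUnion.mp hc
        exact hRk (t s) c hs)
      refine ⟨p, hpd, fun x hx => ?_⟩
      rw [← cnfVal_biUnion]
      exact hp x hx)
    hq
  refine ⟨p, hpd, fun x hx => ?_⟩
  set z := ∑ o, eval (fun i => bitVal (x i)) (w o) * cnfVal (R o) x with hz
  set B := Finset.univ.filter fun i => x i ≠ a i ∧ ¬ CNFHolds (residualCNF F a i) x with hB
  have hzB : z = 1 - (B.card : ℝ) / (2 * n) := by
    have h0 : cnfVal (∅ : Finset (Finset (Lit N))) x = 1 :=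
      if_pos fun t ht => absurd ht (Finset.notMem_empty t)
    have h1 : ∀ i, eval (fun i => bitVal (x i)) (u i) * cnfVal (residualCNF F a i) x =
        eval (fun i => bitVal (x i)) (u i) - 1 / (2 * n : ℝ) *
          if x i ≠ a i ∧ ¬ CNFHolds (residualCNF F a i) x then 1 else 0 := by
      intro i
      rw [hueval, cnfVal]
      by_cases h2 : x i = a i <;> by_cases h3 : CNFHolds (residualCNF F a i) x <;> simp [h2, h3]
    rw [hz, Fintype.sum_option]
    simp only [hw, hR, Option.elim, h0, h1, map_sub, map_one, map_sum]
    rw [Finset.sum_sub_distrib, ← Finset.mul_sum, Finset.sum_boole, ← hB]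
    ring
  have hzF : |cnfVal F x - q.eval z| ≤ η := by
    by_cases hFx : CNFHolds F x
    · have hB0 : B.card = 0 := by
        rw [Finset.card_eq_zero, hB, Finset.filter_eq_empty_iff]
        exact fun i _ h => h.2 (hFx.residualCNF h.1)
      rw [hzB, hB0, cnfVal, if_pos hFx]
      simpa [hq1] using hη
    · have hB1 : 1 ≤ B.card := by
        by_contra! h
        have hB0 : B = ∅ := Finset.card_eq_zero.mp (by omega)
        rw [hB, Finset.filter_eq_empty_iff] at hB0
        refine hFx (cnfHolds_of_residualCNF haF fun i hi => ?_)
        by_contra hc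
        exact hB0 (Finset.mem_univ i) ⟨hi, hc⟩
      have hB2 : B.card ≤ 2 * n := by
        refine (Finset.card_le_card ?_).trans (card_ne_le_of_hammingWeight_le hx ha)
        exact fun i hi => Finset.mem_filter.mpr
          ⟨Finset.mem_univ i, (Finset.mem_filter.mp hi).2.1⟩
      rw [hzB, cnfVal, if_neg hFx, zero_sub, abs_neg]
      exact hqη _ hB1 hB2
  have := hp x hx
  calc _ ≤ |cnfVal F x - q.eval z| + |q.eval z - eval (fun i => bitVal (x i)) p| :=
        abs_sub_le _ _ _
    _ ≤ _ := add_le_add hzF this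

theorem exists_approx_cnfVal_zero {n : ℕ} {F : Finset (Finset (Lit N))}
    (hF : ∀ x ∈ cubeLE N n, ¬ CNFHolds F x) (d : ℕ) {η : ℝ} (hη : 0 ≤ η) :
    ∃ p : MvPolynomial (Fin N) ℝ, p.totalDegree ≤ d ∧
      ∀ x ∈ cubeLE N n, |cnfVal F x - eval (fun i => bitVal (x i)) p| ≤ η :=
  ⟨0, by simp, fun x hx => by simpa [cnfVal, hF x hx] using hη⟩

/-- CNF formulas of width `k` are approximated in degree `k * d` as soon as
`L * (2000 * n / d) ^ k ≤ d`. -/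
theorem exists_approx_cnfVal {n d : ℕ} (hd : 1 ≤ d) (hdn : d ≤ n) (k : ℕ) {L : ℝ} (hL : 1 ≤ L)
    (h : L * (2000 * n / d) ^ k ≤ d) {F : Finset (Finset (Lit N))} (hF : ∀ t ∈ F, t.card ≤ k) :
    ∃ p : MvPolynomial (Fin N) ℝ, p.totalDegree ≤ k * d ∧
      ∀ x ∈ cubeLE N n, |cnfVal F x - eval (fun i => bitVal (x i)) p| ≤ (2 : ℝ) ^ (-L) := by
  have hd0 : (0 : ℝ) < d := by exact_mod_cast hd
  have hdn' : (d : ℝ) ≤ n := by exact_mod_cast hdn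
  induction k generalizing L F with
  | zero =>
    by_cases hF0 : F = ∅
    · refine ⟨1, by simp, fun x hx => ?_⟩
      rw [cnfVal, if_pos (by rw [hF0]; exact fun t ht => absurd ht (Finset.notMem_empty t))]
      simp
      positivity
    · refine exists_approx_cnfVal_zero (fun x hx hFx => ?_) _ (by positivity)
      obtain ⟨t, ht⟩ := Finset.nonempty_iff_ne_empty.mpr hF0
      obtain ⟨l, hl, -⟩ := hFx t ht
      have := Finset.card_pos.mpr ⟨l, hl⟩
      have := hF t ht
      omega
  | succ k ih =>
    by_cases hex : ∃ a ∈ cubeLE N n, CNFHolds F a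
    · obtain ⟨a, ha, haF⟩ := hex
      have hr : 1 ≤ 2000 * (n : ℝ) / d := by
        rw [one_le_div hd0]
        linarith
      have hL' : 2000 * (n * L) / d * (2000 * n / d) ^ k ≤ d := by
        refine le_of_eq_of_le ?_ h
        rw [pow_succ]
        ring
      have hL1 : 1 ≤ 2000 * (n * L) / d := by
        rw [show 2000 * (n * L) / d = 2000 * (n : ℝ) / d * L by ring]
        nlinarith
      have hLd : 2000 * (n * L) / d ≤ d :=
        (le_mul_of_one_le_right (by linarith) (one_le_pow₀ hr)).trans hL'
      obtain ⟨q, hq1, hq2, hq3, hq4⟩ := exists_separating_polynomial hd hdn hL (by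
        rw [div_le_iff₀ hd0] at hLd
        nlinarith [mul_nonneg (hd0.le.trans hdn') (zero_le_one.trans hL)])
      obtain ⟨p, hp1, hp2⟩ := exists_approx_cnfVal_step (hd.trans hdn)
        (fun G hG => ih hL1 hL' hG) hq1 hq3 (by positivity) hq4 hF ha haF
      refine ⟨p, hp1.trans_eq (by ring), fun x hx => (hp2 x hx).trans ?_⟩
      have h1 : coeffNorm q * (2 : ℝ) ^ (-(2000 * (n * L) / d)) ≤ (2 : ℝ) ^ (-L - 1) := by
        refine (mul_le_mul_of_nonneg_right hq2 (by positivity)).trans_eq ?_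
        rw [← Real.rpow_add (by norm_num)]
        congr 1
        ring
      have h2 : (2 : ℝ) ^ (-L) = (2 : ℝ) ^ (-L - 1) * 2 := by
        rw [Real.rpow_sub_one (by norm_num)]
        ring
      linarith
    · push Not at hex
      exact exists_approx_cnfVal_zero hex _ (by positivity)

/-- Every real function on the strings of weight at most `n` is a polynomial of degree at most
`n`. -/
theorem exists_eval_eq_of_hammingWeight_le (g : (Fin N → Bool) → ℝ) (n : ℕ) :
    ∃ p : MvPolynomial (Fin N) ℝ, p.totalDegree ≤ n ∧
      ∀ x ∈ cubeLE N n, g x = eval (fun i => bitVal (x i)) p := by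
  classical
  have hmon : ∀ a x : Fin N → Bool, hammingWeight x ≤ hammingWeight a →
      eval (fun i => bitVal (x i)) (∏ i ∈ Finset.univ.filter fun i => a i = true, X i) =
        if a = x then (1 : ℝ) else 0 := by
    intro a x hxa
    rw [map_prod]
    simp only [eval_X]
    split_ifs with hax
    · subst hax
      exact Finset.prod_eq_one fun i hi => by simp [bitVal, (Finset.mem_filter.mp hi).2]
    · have : ∃ i, a i = true ∧ x i = false := by
        by_contra! hc
        have hsub : (Finset.univ.filter fun i => a i = true) ⊆
            Finset.univ.filter fun i => x i = true := by
          intro i hi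
          simpa using hc i (Finset.mem_filter.mp hi).2
        have heq := Finset.eq_of_subset_of_card_le hsub hxa
        refine hax (funext fun i => ?_)
        have := congrArg (i ∈ ·) heq
        simp only [Finset.mem_filter, Finset.mem_univ, true_and, eq_iff_iff] at this
        exact Bool.eq_iff_iff.mpr this
      obtain ⟨i, h1, h2⟩ := this
      exact Finset.prod_eq_zero (i := i) (by simp [h1]) (by simp [bitVal, h2])
  have hextend : ∀ (m : ℕ) (r : MvPolynomial (Fin N) ℝ), r.totalDegree ≤ m →
      (∀ x, hammingWeight x < m → g x = eval (fun i => bitVal (x i)) r) →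
      ∃ p : MvPolynomial (Fin N) ℝ, p.totalDegree ≤ m ∧
        ∀ x ∈ cubeLE N m, g x = eval (fun i => bitVal (x i)) p := by
    intro m r hr hgr
    refine ⟨r + ∑ a ∈ Finset.univ.filter (fun a : Fin N → Bool => hammingWeight a = m),
      C (g a - eval (fun i => bitVal (a i)) r) *
        ∏ i ∈ Finset.univ.filter fun i => a i = true, X i, ?_, fun x hx => ?_⟩
    · refine (totalDegree_add _ _).trans (max_le hr (totalDegree_finsetSum_le fun a ha => ?_))
      refine (totalDegree_mul _ _).trans ?_
      rw [totalDegree_C, zero_add]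
      refine (totalDegree_finsetProd _ _).trans ?_
      rw [← (Finset.mem_filter.mp ha).2]
      simp [hammingWeight]
    · have hx' : hammingWeight x ≤ m := hx
      rw [map_add, map_sum, Finset.sum_congr rfl fun a ha => by
        rw [map_mul, eval_C, hmon a x (hx'.trans_eq (Finset.mem_filter.mp ha).2.symm)]]
      simp only [mul_ite, mul_one, mul_zero, Finset.sum_ite_eq', Finset.mem_filter,
        Finset.mem_univ, true_and]
      split_ifs with hxm
      · ring
      · rw [add_zero]
        exact hgr x (lt_of_le_of_ne hx' hxm)
  induction n with
  | zero => exact hextend 0 0 (by simp) (by simp)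
  | succ n ih =>
    obtain ⟨r, hr, hgr⟩ := ih
    exact hextend (n + 1) r (by omega) fun x hx => hgr x (Nat.lt_succ_iff.mp hx)

end ConjunctiveNormalForms

section ApproximateDegree

theorem approxDegree_le {N : ℕ} {X : Set (Fin N → Bool)} {f : X → Bool} {ε : ℝ}
    {p : MvPolynomial (Fin N) ℝ} (hp : Approximates p f ε) {d : ℕ} (hd : p.totalDegree ≤ d) :
    approxDegree ε f ≤ d :=
  by
  have h : approxDegree ε f ≤ p.totalDegree := Nat.sInf_le ⟨p, rfl, hp⟩
  exact h.trans hd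

theorem approxDegree_le_weight {N n : ℕ} (f : cubeLE N n → Bool) {ε : ℝ} (hε : 0 ≤ ε) :
    approxDegree ε f ≤ n := by
  classical
  obtain ⟨p, hpd, hp⟩ := exists_eval_eq_of_hammingWeight_le
    (fun x => if h : x ∈ cubeLE N n then bitVal (f ⟨x, h⟩) else 0) n
  refine approxDegree_le (p := p) (fun x => ?_) hpd
  rw [← hp x.1 x.2, dif_pos x.2]
  simpa using hε

theorem approxDegree_not_le {N : ℕ} {X : Set (Fin N → Bool)} (f : X → Bool) {ε : ℝ} (hε : 0 ≤ ε) :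
    approxDegree ε f ≤ approxDegree ε fun x => !f x := by
  obtain ⟨p, hpd, hp⟩ := exists_approximates_totalDegree_eq (fun x => !f x) hε
  refine approxDegree_le (p := 1 - p) (fun x => ?_) ?_
  · have h := hp x
    rw [abs_sub_comm] at h
    refine le_of_eq_of_le ?_ h
    rw [map_sub, map_one]
    cases hfx : f x <;> simp [bitVal, hfx]
  · rw [← hpd]
    exact (MvPolynomial.totalDegree_sub _ _).trans (by simp)

theorem IsKDNF.isKCNF_not {N k : ℕ} {X : Set (Fin N → Bool)} {f : X → Bool} (hf : IsKDNF k f) :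
    IsKCNF k fun x => !f x := by
  classical
  obtain ⟨F, hFk, hF⟩ := hf
  refine ⟨F.image fun t => t.image fun l => (l.1, !l.2), ?_, fun x => ?_⟩
  · intro t ht
    obtain ⟨s, hs, rfl⟩ := Finset.mem_image.mp ht
    exact Finset.card_image_le.trans (hFk s hs)
  · rw [Bool.not_eq_true', ← Bool.not_eq_true, hF x]
    simp only [Finset.forall_mem_image, Finset.exists_mem_image, Lit.Holds]
    push Not
    simp only [Bool.eq_not, ne_eq]

theorem IsKCNF.exists_approx {N n d k : ℕ} (hd : 1 ≤ d) (hdn : d ≤ n) {f : cubeLE N n → Bool}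
    (hf : IsKCNF k f) {L : ℝ} (hL : 1 ≤ L) (h : L * (2000 * n / d) ^ k ≤ d) :
    approxDegree ((2 : ℝ) ^ (-L)) f ≤ k * d := by
  obtain ⟨F, hFk, hF⟩ := hf
  obtain ⟨p, hpd, hp⟩ := exists_approx_cnfVal hd hdn k hL h hFk
  refine approxDegree_le (p := p) (fun x => ?_) hpd
  have hval : bitVal (f x) = cnfVal F x.1 := by
    by_cases hx : CNFHolds F x.1
    · simp [cnfVal, hx, bitVal, (hF x).mpr hx]
    · have hfx : ¬ f x = true := fun h => hx ((hF x).mp h)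
      simp [cnfVal, hx, bitVal, hfx]
  rw [hval]
  exact hp x.1 x.2

theorem natCast_le_two_mul_sqrt_two_pow (k : ℕ) : (k : ℝ) ≤ 2 * √2 ^ k := by
  have h1 : ∀ k : ℕ, k ^ 2 ≤ 4 * 2 ^ k := by
    intro k
    rcases Nat.lt_or_ge k 4 with h | h
    · interval_cases k <;> norm_num
    · induction k, h using Nat.le_induction with
      | base => norm_num
      | succ k hk ih =>
        rw [pow_succ 2 k]
        nlinarith
  have h2 : (√2 ^ k) ^ 2 = (2 : ℝ) ^ k := by
    rw [← pow_mul, mul_comm, pow_mul, Real.sq_sqrt (by norm_num)]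
  have h3 : (k : ℝ) ^ 2 ≤ (2 * √2 ^ k) ^ 2 := by
    rw [mul_pow, h2]
    have := h1 k
    norm_num
    exact_mod_cast this
  exact (sq_le_sq₀ (by positivity) (by positivity)).mp h3

theorem IsKCNF.approxDegree_le {N n k : ℕ} {f : cubeLE N n → Bool} (hf : IsKCNF k f) {L : ℝ}
    (hL : 1 ≤ L) :
    (approxDegree ((2 : ℝ) ^ (-L)) f : ℝ) ≤
      8000 * √2 ^ k * (n : ℝ) ^ ((k : ℝ) / ((k : ℝ) + 1)) * L ^ (1 / ((k : ℝ) + 1)) := by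
  rcases Nat.eq_zero_or_pos n with rfl | hn
  · have := approxDegree_le_weight f (show (0 : ℝ) ≤ (2 : ℝ) ^ (-L) by positivity)
    rw [Nat.le_zero.mp this, Nat.cast_zero]
    positivity
  have hn1 : (1 : ℝ) ≤ n := by exact_mod_cast hn
  have hn0 : (0 : ℝ) < n := by linarith
  have hL0 : 0 < L := by linarith
  have hk0 : (0 : ℝ) < k + 1 := by positivity
  set E := (n : ℝ) ^ ((k : ℝ) / ((k : ℝ) + 1)) * L ^ (1 / ((k : ℝ) + 1)) with hE
  have hE1 : 1 ≤ E := one_le_mul_of_one_le_of_one_le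
    (Real.one_le_rpow hn1 (by positivity)) (Real.one_le_rpow hL (by positivity))
  have hEpow : E ^ (k + 1) = (n : ℝ) ^ k * L := by
    rw [hE, mul_pow, ← Real.rpow_natCast, ← Real.rpow_natCast, ← Real.rpow_mul hn0.le,
      ← Real.rpow_mul hL0.le, Nat.cast_succ, div_mul_cancel₀ _ hk0.ne', div_mul_cancel₀ _ hk0.ne',
      Real.rpow_natCast, Real.rpow_one]
  set d := ⌈2000 * E⌉₊ with hd
  have hdE : 2000 * E ≤ d := Nat.le_ceil _
  have hdE' : (d : ℝ) ≤ 4000 * E := by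
    have := Nat.ceil_lt_add_one (show 0 ≤ 2000 * E by positivity)
    linarith
  have hs1 : (1 : ℝ) ≤ √2 ^ k := one_le_pow₀ (Real.one_le_sqrt.mpr (by norm_num))
  rw [mul_assoc, ← hE]
  rcases le_or_gt d n with hdn | hdn
  · have hd1 : 1 ≤ d := Nat.one_le_ceil_iff.mpr (by positivity)
    have hd0 : (0 : ℝ) < d := by exact_mod_cast hd1
    have h : L * (2000 * n / d) ^ k ≤ d := by
      rw [div_pow, ← mul_div_assoc, div_le_iff₀ (by positivity), ← pow_succ']
      calc L * (2000 * (n : ℝ)) ^ k = 2000 ^ k * E ^ (k + 1) := by rw [hEpow, mul_pow]; ring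
        _ ≤ 2000 ^ (k + 1) * E ^ (k + 1) := by
            gcongr
            · norm_num
            · omega
        _ = (2000 * E) ^ (k + 1) := (mul_pow _ _ _).symm
        _ ≤ (d : ℝ) ^ (k + 1) := by gcongr
    have h1 : (approxDegree ((2 : ℝ) ^ (-L)) f : ℝ) ≤ k * d := by
      exact_mod_cast hf.exists_approx hd1 hdn hL h
    calc _ ≤ (k : ℝ) * d := h1
      _ ≤ 2 * √2 ^ k * (4000 * E) :=
          mul_le_mul (natCast_le_two_mul_sqrt_two_pow k) hdE' hd0.le (by positivity)
      _ = _ := by ring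
  · have h1 : (approxDegree ((2 : ℝ) ^ (-L)) f : ℝ) ≤ n := by
      exact_mod_cast approxDegree_le_weight f (by positivity)
    have h2 : (n : ℝ) < d := by exact_mod_cast hdn
    nlinarith

theorem approxDegree_le_of_isKDNF_or_isKCNF {N n k : ℕ} {f : cubeLE N n → Bool} {ε : ℝ}
    (hε0 : 0 < ε) (hε : ε ≤ 1 / 2) (hf : IsKDNF k f ∨ IsKCNF k f) :
    (approxDegree ε f : ℝ) ≤ 8000 * √2 ^ k * (n : ℝ) ^ ((k : ℝ) / ((k : ℝ) + 1)) *
      Real.logb 2 (1 / ε) ^ (1 / ((k : ℝ) + 1)) := by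
  have hL : 1 ≤ Real.logb 2 (1 / ε) := by
    rw [Real.le_logb_iff_rpow_le (by norm_num) (by positivity), Real.rpow_one,
      le_div_iff₀ hε0]
    linarith
  have hεL : (2 : ℝ) ^ (-Real.logb 2 (1 / ε)) = ε := by
    rw [one_div, Real.logb_inv, neg_neg, Real.rpow_logb (by norm_num) (by norm_num) hε0]
  have key : ∀ g : cubeLE N n → Bool, IsKCNF k g → (approxDegree ε g : ℝ) ≤ 8000 * √2 ^ k *
      (n : ℝ) ^ ((k : ℝ) / ((k : ℝ) + 1)) * Real.logb 2 (1 / ε) ^ (1 / ((k : ℝ) + 1)) := by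
    intro g hg
    have := hg.approxDegree_le hL
    rwa [hεL] at this
  rcases hf with hf | hf
  · have h : (approxDegree ε f : ℝ) ≤ approxDegree ε fun x => !f x := by
      exact_mod_cast approxDegree_not_le f hε0.le
    exact h.trans (key _ hf.isKCNF_not)
  · exact key f hf

end ApproximateDegree

theorem theorem1p2 :
    (∃ c : ℝ, 1 < c ∧
      ∀ (N n k : ℕ) (f : cubeLE N n → Bool) (ε : ℝ), 0 < ε → ε ≤ 1 / 2 →
        (IsKDNF k f ∨ IsKCNF k f) →
          (approxDegree ε f : ℝ) ≤
            c * Real.sqrt 2 ^ k * (n : ℝ) ^ ((k : ℝ) / ((k : ℝ) + 1)) *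
              Real.logb 2 (1 / ε) ^ (1 / ((k : ℝ) + 1))) ∧
    (∀ k : ℕ, ∃ C : ℝ, 0 < C ∧
      ∀ (N n : ℕ) (f : cubeLE N n → Bool), (IsKDNF k f ∨ IsKCNF k f) →
        (approxDegree (1 / 3) f : ℝ) ≤ C * (n : ℝ) ^ ((k : ℝ) / ((k : ℝ) + 1))) := by
  refine ⟨⟨8000, by norm_num, fun N n k f ε h0 h1 hf =>
    approxDegree_le_of_isKDNF_or_isKCNF h0 h1 hf⟩, fun k =>
    ⟨8000 * √2 ^ k * Real.logb 2 (1 / (1 / 3)) ^ (1 / ((k : ℝ) + 1)), ?_, fun N n f hf => ?_⟩⟩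
  · have : 0 < Real.logb 2 (1 / (1 / 3)) := Real.logb_pos (by norm_num) (by norm_num)
    positivity
  · refine (approxDegree_le_of_isKDNF_or_isKCNF (by norm_num) (by norm_num) hf).trans_eq ?_
    ring
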